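/- Let $\Gamma$ be a finite rooted tree, with edges directed away from the root $x_0$. The level of a vertex is its distance from $x_0$, and the height $h$ of $\Gamma$ is the maximal level of a vertex. Suppose $h\ge 1$ and that $\Gamma$ is $k$-nary, i.e. every vertex of level at most $h-1$ has exactly $k$ outgoing edges. Let $R$ be the standard graded polynomial ring over a field $\mathsf{k}$ whose variables are the vertices of $\Gamma$, and for $t\ge1$ let $I_t(\Gamma)\subset R$ be the ideal generated by the monomials $x_{i_1}\cdots x_{i_t}$ such that $x_{i_1},\dots,x_{i_t}$ is a directed path on $t$ distinct vertices of $\Gamma$. For a homogeneous ideal $I\subsetneq R$ let $\operatorname{reg}(R/I)=\max\{j-i : \beta_{i,j}(R/I)\neq 0\}$ be the Castelnuovo–Mumford regularity, where $\beta_{i,j}(R/I)$ is the number of summands $R(-j)$ in homological degree $i$ of the minimal graded free resolution of $R/I$. Then $$\operatorname{reg}\bigl(R/I_{h+1}(\Gamma)\bigr)=\frac{k^{h}-1}{k-1}\qquad\text{and}\qquad \operatorname{reg}\bigl(R/I_{h}(\Gamma)\bigr)=\frac{k^{h}-k}{k-1},$$ where for $k=1$ the two quotients are read as the geometric sums $\sum_{i=0}^{h-1}k^i=h$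 and $\sum_{i=1}^{h-1}k^i=h-1$. -/

import Mathlib

open scoped BigOperators

/-- A rooted tree on the vertex set `V`: a tree with a distinguished vertex, the root. -/
structure DirectedRootedTree (V : Type*) where
  graph : SimpleGraph V
  isTree : graph.IsTree
  root : V

namespace DirectedRootedTree

variable {V : Type*}

/-- The level of a vertex: its distance from the root. -/
noncomputable def level (T : DirectedRootedTree V) (x : V) : ℕ := T.graph.dist T.root x

/-- The directed edges: the edges of the tree, directed away from the root. -/
def Edge (T : DirectedRootedTree V) (x y : V) : Prop :=
  T.graph.Adj x y ∧ T.level y = T.level x + 1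

/-- The outdegree of a vertex: the number of edges directed away from it. -/
noncomputable def outDegree (T : DirectedRootedTree V) (x : V) : ℕ := {y : V | T.Edge x y}.ncard

/-- The height: the maximal level of a vertex. -/
noncomputable def height [Fintype V] (T : DirectedRootedTree V) : ℕ :=
  Finset.univ.sup T.level

/-- `k`-nary: every vertex of level at most `height - 1` has outdegree `k`. -/
def IsNary [Fintype V] (T : DirectedRootedTree V) (k : ℕ) : Prop :=
  ∀ x : V, T.level x < T.height → T.outDegree x = k

/-- A directed path on `t` vertices: distinct vertices `x₁, …, x_t`
with a directed edge from each one to the next. -/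
def IsDirectedPath (T : DirectedRootedTree V) (t : ℕ) (p : List V) : Prop :=
  p.length = t ∧ p.Nodup ∧ p.IsChain T.Edge

/-- The `t`-path ideal, in the polynomial ring over `K` whose variables are the vertices. -/
noncomputable def pathIdeal (K : Type*) [Field K] (T : DirectedRootedTree V) (t : ℕ) : Ideal (MvPolynomial V K) :=
  Ideal.span {f | ∃ p : List V, T.IsDirectedPath t p ∧ f = (p.map MvPolynomial.X).prod}

end DirectedRootedTree

section Regularity

variable {V K : Type*} [Field K]

/-- The homogeneous elements of degree `n` of the graded free module `⨁ₐ R(-deg a)`,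
`R = K[V]`, whose basis element number `a` has degree `deg a`. -/
def freeDegreePart {r : ℕ} (deg : Fin r → ℕ) (n : ℕ) : Set (Fin r → MvPolynomial V K) :=
  {v | ∀ a, ∀ m ∈ (v a).support, m.degree + deg a = n}

/-- The homogeneous elements of degree `n` of the graded module `R/I`, `R = K[V]`. -/
def quotientDegreePart (I : Ideal (MvPolynomial V K)) (n : ℕ) : Set (MvPolynomial V K ⧸ I) :=
  {x | ∃ p : MvPolynomial V K, p.IsHomogeneous n ∧ Ideal.Quotient.mk I p = x}

/-- A minimal graded free resolution `⋯ → F₂ → F₁ → F₀ → R/I → 0` of `R/I`, `R = K[V]`, with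
`F_i = ⨁ₐ R(-deg i a)` of finite rank `rank i`: an exact sequence of degree-preserving
`R`-linear maps in which the image of `F_{i+1}` lies in `𝔪 F_i`, `𝔪` the ideal generated by the
variables. -/
structure MinimalGradedFreeResolution (I : Ideal (MvPolynomial V K)) where
  rank : ℕ → ℕ
  deg : (i : ℕ) → Fin (rank i) → ℕ
  aug : (Fin (rank 0) → MvPolynomial V K) →ₗ[MvPolynomial V K] (MvPolynomial V K ⧸ I)
  d : (i : ℕ) → (Fin (rank (i + 1)) → MvPolynomial V K) →ₗ[MvPolynomial V K]
    (Fin (rank i) → MvPolynomial V K)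
  aug_graded : ∀ n, ∀ v ∈ freeDegreePart (deg 0) n, aug v ∈ quotientDegreePart I n
  d_graded : ∀ i n, ∀ v ∈ freeDegreePart (deg (i + 1)) n, d i v ∈ freeDegreePart (deg i) n
  aug_surjective : Function.Surjective aug
  exact_zero : Function.Exact (d 0) aug
  exact_succ : ∀ i, Function.Exact (d (i + 1)) (d i)
  minimal : ∀ i v a, d i v a ∈ Ideal.span (Set.range (MvPolynomial.X : V → MvPolynomial V K))

/-- The graded Betti number `β_{i,j}`: the number of summands `R(-j)` of `F_i`. -/
def MinimalGradedFreeResolution.betti {I : Ideal (MvPolynomial V K)}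
    (F : MinimalGradedFreeResolution I) (i j : ℕ) : ℕ :=
  (Finset.univ.filter fun a => F.deg i a = j).card

/-- `reg(R/I) = r`: the module `R/I` has a minimal graded free resolution, and
`r = max {j - i : β_{i,j}(R/I) ≠ 0}`, where the Betti numbers may be read off from any minimal
graded free resolution. -/
def HasRegularity (I : Ideal (MvPolynomial V K)) (r : ℤ) : Prop :=
  Nonempty (MinimalGradedFreeResolution I) ∧
    ∀ F : MinimalGradedFreeResolution I,
      IsGreatest {s : ℤ | ∃ i j : ℕ, F.betti i j ≠ 0 ∧ s = (j : ℤ) - (i : ℤ)} r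

end Regularity

/-!
The proof reads the regularity off the Taylor resolution of the path ideal, for both ideals at once.

Any two graded free resolutions of `R/I` are homotopy equivalent, so a homogeneous element of one
resolution `F` that survives in the homology of `F ⊗ K`, in homological degree `i` and internal
degree `j`, forces a basis element of degree `j` in homological degree `i` of every other one
(`GradedFree.Resolution.exists_deg_eq`). Applied from a minimal resolution to the Taylor resolution,
whose basis elements are the sets `A` of generators, placed in homological degree `|A|` and in
degree `deg lcm A`, this bounds the regularity by the maximum of `deg lcm A - |A|`. Applied in the
other direction, it shows that a set `A₀` contributes a nonzero Betti number as soon as its lcm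
changes whenever a generator is removed or added
(`GradedFree.hasRegularity_monomialIdeal`). The Taylor complex is exact because its part of
multidegree `μ` is the chain complex of the simplex on the generators dividing `x^μ`, which is a
cone (`GradedFree.bdry_cone`, `GradedFree.exists_taylorD_eq`).

Let `h` be the height and `t ∈ {h, h + 1}`. The generators of `I_t` are the vertex sets of the
directed paths on `t` vertices, and `deg lcm A` is the size of the union of the paths in `A`. Such a
path has at most one vertex outside the levels `h + 1 - t, …, h - 1`: it cannot contain both a
vertex of level `h` and, when `t = h`, the root. Hence the union has at most `|A| + r` vertices,
where `r` is the number of vertices in these levels. Equality holds for the set `A₀` of all paths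
that end in level `h`. Each of them contains a vertex of level `h` that is on no other path, and for
`t = h` any further path contains the root, which is on no path of `A₀`; so the lcm of `A₀` changes
as required. Since level `i` has `k ^ i` vertices, `r` is the geometric sum
`∑ k ^ i` over `h + 1 - t ≤ i < h` (`DirectedRootedTree.hasRegularity_pathIdeal`).
-/

/-! ### Homogeneous vectors in graded free modules -/

namespace GradedFree

section Vectors

variable {V K : Type*} [Field K] {ι κ : Type*}

/-- `v` is homogeneous of degree `n` in the graded free module `⨁ₐ R(-deg a)`; for `ι = Fin r`
this is membership in `freeDegreePart deg n`. -/
def IsHomog (deg : ι → ℕ) (n : ℕ) (v : ι → MvPolynomial V K) : Prop :=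
  ∀ a, ∀ m ∈ (v a).support, m.degree + deg a = n

/-- A linear map between graded free modules that preserves degrees. -/
def IsGradedMap (deg : ι → ℕ) (deg' : κ → ℕ)
    (f : (ι → MvPolynomial V K) →ₗ[MvPolynomial V K] (κ → MvPolynomial V K)) : Prop :=
  ∀ n v, IsHomog deg n v → IsHomog deg' n (f v)

/-- The component of degree `n` of a vector of `⨁ₐ R(-deg a)`. -/
noncomputable def comp (deg : ι → ℕ) (n : ℕ) :
    (ι → MvPolynomial V K) →ₗ[K] (ι → MvPolynomial V K) :=
  LinearMap.pi fun a =>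
    if deg a ≤ n then MvPolynomial.homogeneousComponent (n - deg a) ∘ₗ LinearMap.proj a else 0

theorem coeff_comp (deg : ι → ℕ) (n : ℕ) (v : ι → MvPolynomial V K) (a : ι) (m : V →₀ ℕ) :
    (comp deg n v a).coeff m = if m.degree + deg a = n then (v a).coeff m else 0 := by
  by_cases h : deg a ≤ n
  · have : (m.degree = n - deg a) ↔ (m.degree + deg a = n) := by omega
    simp [comp, h, MvPolynomial.coeff_homogeneousComponent, this]
  · have : ¬ (m.degree + deg a = n) := by omega
    simp [comp, h, this]

theorem isHomog_comp (deg : ι → ℕ) (n : ℕ) (v : ι → MvPolynomial V K) :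
    IsHomog deg n (comp deg n v) := by
  intro a m hm
  rw [MvPolynomial.mem_support_iff, coeff_comp] at hm
  by_contra h
  simp [h] at hm

theorem IsHomog.comp_eq {deg : ι → ℕ} {n : ℕ} {v : ι → MvPolynomial V K} (hv : IsHomog deg n v)
    (n' : ℕ) : comp deg n' v = if n' = n then v else 0 := by
  ext a m
  rw [coeff_comp]
  by_cases hm : m ∈ (v a).support
  · have := hv a m hm
    by_cases hn : n' = n
    · simp [hn, this]
    · have h2 : ¬ (m.degree + deg a = n') := by omega
      simp [hn, h2]
  · rw [MvPolynomial.notMem_support_iff] at hm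
    split_ifs <;> simp [hm]

theorem IsHomog.comp_self {deg : ι → ℕ} {n : ℕ} {v : ι → MvPolynomial V K}
    (hv : IsHomog deg n v) : comp deg n v = v := by
  simpa using hv.comp_eq n

theorem exists_sum_comp [Fintype ι] (deg : ι → ℕ) (v : ι → MvPolynomial V K) :
    ∃ N, v = ∑ n ∈ Finset.range N, comp deg n v := by
  refine ⟨Finset.univ.sup (fun a => (v a).totalDegree + deg a) + 1, ?_⟩
  ext a m
  rw [Finset.sum_apply, MvPolynomial.coeff_sum]
  simp only [coeff_comp, Finset.sum_ite_eq, Finset.mem_range]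
  split_ifs with h
  · rfl
  · by_contra h0
    have h1 : m.degree ≤ (v a).totalDegree :=
      MvPolynomial.le_totalDegree (MvPolynomial.mem_support_iff.2 h0)
    have h2 := Finset.le_sup (f := fun a => (v a).totalDegree + deg a) (Finset.mem_univ a)
    omega

theorem IsGradedMap.comp_apply [Fintype ι] {deg : ι → ℕ} {deg' : κ → ℕ}
    {f : (ι → MvPolynomial V K) →ₗ[MvPolynomial V K] (κ → MvPolynomial V K)}
    (hf : IsGradedMap deg deg' f) (n : ℕ) (v : ι → MvPolynomial V K) :
    f (comp deg n v) = comp deg' n (f v) := by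
  obtain ⟨N, hN⟩ := exists_sum_comp deg v
  have h1 : ∀ i, comp deg' n (f (comp deg i v)) = if n = i then f (comp deg i v) else 0 :=
    fun i => (hf i _ (isHomog_comp deg i v)).comp_eq n
  have h2 : ∀ i, comp deg n (comp deg i v) = if n = i then comp deg i v else 0 :=
    fun i => (isHomog_comp deg i v).comp_eq n
  conv_lhs => rw [hN]
  conv_rhs => rw [hN]
  simp only [map_sum, h1, h2, Finset.sum_ite_eq]
  split_ifs <;> simp

theorem IsHomog.zero (deg : ι → ℕ) (n : ℕ) : IsHomog deg n (0 : ι → MvPolynomial V K) := by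
  intro a m hm
  simp at hm

theorem IsHomog.add {deg : ι → ℕ} {n : ℕ} {v w : ι → MvPolynomial V K} (hv : IsHomog deg n v)
    (hw : IsHomog deg n w) : IsHomog deg n (v + w) := by
  classical
  intro a m hm
  rcases Finset.mem_union.1 (MvPolynomial.support_add hm) with h | h
  exacts [hv a m h, hw a m h]

theorem IsHomog.sum {α : Type*} {deg : ι → ℕ} {n : ℕ} (s : Finset α)
    (v : α → ι → MvPolynomial V K) (hv : ∀ i ∈ s, IsHomog deg n (v i)) :
    IsHomog deg n (∑ i ∈ s, v i) := by
  classical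
  induction s using Finset.induction_on with
  | empty => simpa using IsHomog.zero deg n
  | insert a s ha ih =>
    rw [Finset.sum_insert ha]
    exact (hv a (Finset.mem_insert_self _ _)).add
      (ih fun i hi => hv i (Finset.mem_insert_of_mem hi))

theorem isHomog_single [DecidableEq ι] (deg : ι → ℕ) (a : ι) :
    IsHomog deg (deg a) (Pi.single a (1 : MvPolynomial V K)) := by
  classical
  intro b m hm
  by_cases hb : b = a
  · subst hb
    rw [MvPolynomial.mem_support_iff, Pi.single_eq_same, MvPolynomial.coeff_one] at hm
    have : 0 = m := by by_contra h; simp [h] at hm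
    subst this
    simp
  · simp [Pi.single_eq_of_ne hb] at hm

theorem map_eq_sum [Fintype ι] [DecidableEq ι] {M : Type*} [AddCommGroup M]
    [Module (MvPolynomial V K) M] (f : (ι → MvPolynomial V K) →ₗ[MvPolynomial V K] M)
    (v : ι → MvPolynomial V K) : f v = ∑ a, v a • f (Pi.single a 1) := by
  conv_lhs => rw [pi_eq_sum_univ' v]
  simp only [map_sum, map_smul]

theorem isGradedMap_of_single [Fintype ι] [DecidableEq ι] {deg : ι → ℕ} {deg' : κ → ℕ}
    {f : (ι → MvPolynomial V K) →ₗ[MvPolynomial V K] (κ → MvPolynomial V K)}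
    (hf : ∀ a, IsHomog deg' (deg a) (f (Pi.single a 1))) : IsGradedMap deg deg' f := by
  classical
  intro n v hv
  rw [map_eq_sum]
  refine IsHomog.sum _ _ fun a _ b m hm => ?_
  obtain ⟨m₁, h₁, m₂, h₂, rfl⟩ := Finset.mem_add.1 (MvPolynomial.support_mul _ _ hm)
  have e₁ := hv a m₁ h₁
  have e₂ := hf a b m₂ h₂
  rw [map_add]
  omega

/-- A map out of a free module lifts through `g` as soon as its values on the basis do; the lifts
of these values may be prescribed to satisfy `P`. -/
theorem exists_lift [Fintype ι] [DecidableEq ι] {M : Type*} [AddCommGroup M]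
    [Module (MvPolynomial V K) M] (g : (κ → MvPolynomial V K) →ₗ[MvPolynomial V K] M)
    (f : (ι → MvPolynomial V K) →ₗ[MvPolynomial V K] M)
    (P : ι → (κ → MvPolynomial V K) → Prop)
    (h : ∀ a, ∃ w, P a w ∧ g w = f (Pi.single a 1)) :
    ∃ φ : (ι → MvPolynomial V K) →ₗ[MvPolynomial V K] (κ → MvPolynomial V K),
      (∀ a, P a (φ (Pi.single a 1))) ∧ ∀ v, g (φ v) = f v := by
  choose w hw hgw using h
  refine ⟨(Pi.basisFun (MvPolynomial V K) ι).constr ℕ w, fun a => ?_, fun v => ?_⟩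
  · rw [← Pi.basisFun_apply, Module.Basis.constr_basis]
    exact hw a
  · rw [map_eq_sum f v, Module.Basis.constr_apply_fintype]
    simp [hgw]

theorem mem_idealOfVars_iff {p : MvPolynomial V K} :
    p ∈ MvPolynomial.idealOfVars V K ↔ p.coeff 0 = 0 := by
  rw [MvPolynomial.idealOfVars, ← Set.image_univ, MvPolynomial.mem_ideal_span_X_image]
  constructor
  · intro h
    by_contra h0
    obtain ⟨i, -, hi⟩ := h 0 (MvPolynomial.mem_support_iff.2 h0)
    simp at hi
  · intro h m hm
    by_contra! h0
    have : m = 0 := by ext i; exact h0 i (Set.mem_univ _)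
    subst this
    exact MvPolynomial.mem_support_iff.1 hm h

/-- A homogeneous vector lies in `𝔪 F` if no basis element of `F` has its degree. -/
theorem IsHomog.mem_idealOfVars {deg : ι → ℕ} {n : ℕ} {v : ι → MvPolynomial V K}
    (hv : IsHomog deg n v) {a : ι} (h : deg a ≠ n) : v a ∈ MvPolynomial.idealOfVars V K := by
  rw [mem_idealOfVars_iff]
  by_contra h0
  have := hv a 0 (MvPolynomial.mem_support_iff.2 h0)
  simp [h] at this

end Vectors

/-! ### Comparison of graded free resolutions -/

/-- A graded free resolution of `R/I`, `R = K[V]`, which need not be minimal. The basis of the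
`i`-th module is indexed by an arbitrary finite type. -/
structure Resolution.{u, v, w} {V : Type u} {K : Type v} [Field K]
    (I : Ideal (MvPolynomial V K)) where
  ι : ℕ → Type w
  fin : ∀ i, Fintype (ι i)
  deg : (i : ℕ) → ι i → ℕ
  aug : (ι 0 → MvPolynomial V K) →ₗ[MvPolynomial V K] (MvPolynomial V K ⧸ I)
  d : (i : ℕ) → (ι (i + 1) → MvPolynomial V K) →ₗ[MvPolynomial V K] (ι i → MvPolynomial V K)
  aug_graded : ∀ n v, IsHomog (deg 0) n v → aug v ∈ quotientDegreePart I n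
  d_graded : ∀ i, IsGradedMap (deg (i + 1)) (deg i) (d i)
  aug_surjective : Function.Surjective aug
  exact_zero : Function.Exact (d 0) aug
  exact_succ : ∀ i, Function.Exact (d (i + 1)) (d i)

attribute [instance] Resolution.fin

/-- A minimal graded free resolution, with minimality forgotten. -/
def ofMinimal {V K : Type*} [Field K] {I : Ideal (MvPolynomial V K)}
    (F : MinimalGradedFreeResolution I) : Resolution I where
  ι i := Fin (F.rank i)
  fin _ := inferInstance
  deg := F.deg
  aug := F.aug
  d := F.d
  aug_graded := F.aug_graded
  d_graded := F.d_graded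
  aug_surjective := F.aug_surjective
  exact_zero := F.exact_zero
  exact_succ := F.exact_succ

namespace Resolution

variable {V K : Type*} [Field K] {I : Ideal (MvPolynomial V K)}

/-- The boundary of `x ∈ F_i` lies in `𝔪 F_{i-1}`; no condition for `i = 0`. -/
def BoundaryMem (F : Resolution I) : (i : ℕ) → (F.ι i → MvPolynomial V K) → Prop
  | 0, _ => True
  | i + 1, x => ∀ a, F.d i x a ∈ MvPolynomial.idealOfVars V K

theorem exists_homog_d_eq (F : Resolution I) {i n : ℕ} {z : F.ι i → MvPolynomial V K}
    (hz : IsHomog (F.deg i) n z) (h : ∃ w, F.d i w = z) :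
    ∃ w, IsHomog (F.deg (i + 1)) n w ∧ F.d i w = z := by
  obtain ⟨w, rfl⟩ := h
  refine ⟨comp _ n w, isHomog_comp _ _ _, ?_⟩
  rw [(F.d_graded i).comp_apply, hz.comp_self]

theorem exists_homog_aug_eq (F : Resolution I)
    (hI : ∀ p ∈ I, ∀ n, MvPolynomial.homogeneousComponent n p ∈ I)
    {n : ℕ} {x : MvPolynomial V K ⧸ I} (hx : x ∈ quotientDegreePart I n) :
    ∃ w, IsHomog (F.deg 0) n w ∧ F.aug w = x := by
  obtain ⟨p, hp, rfl⟩ := hx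
  obtain ⟨v, hv⟩ := F.aug_surjective (Ideal.Quotient.mk I p)
  obtain ⟨N, hN⟩ := exists_sum_comp (F.deg 0) v
  choose q hq hqv using fun i => F.aug_graded i _ (isHomog_comp (F.deg 0) i v)
  refine ⟨comp _ n v, isHomog_comp _ _ _, ?_⟩
  rw [← hqv, Ideal.Quotient.eq]
  have hmem : (∑ i ∈ Finset.range N, q i) - p ∈ I := by
    rw [← Ideal.Quotient.eq, map_sum, ← hv]
    conv_rhs => rw [hN, map_sum]
    exact Finset.sum_congr rfl fun i _ => hqv i
  have hn := hI _ hmem n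
  have hq' : ∀ i, MvPolynomial.homogeneousComponent n (q i) = if n = i then q i else 0 := by
    intro i
    rw [MvPolynomial.homogeneousComponent_of_mem (hq i)]
  rw [map_sub, map_sum, MvPolynomial.homogeneousComponent_of_mem hp, if_pos rfl] at hn
  simp only [hq', Finset.sum_ite_eq, Finset.mem_range] at hn
  split_ifs at hn with hnN
  · exact hn
  · have h0 : comp (F.deg 0) n v = 0 := by
      conv_lhs => rw [hN]
      rw [map_sum]
      refine Finset.sum_eq_zero fun i hi => ?_
      rw [(isHomog_comp _ i v).comp_eq, if_neg]
      have := Finset.mem_range.1 hi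
      omega
    have h1 : q n ∈ I := by
      rw [← Ideal.Quotient.eq_zero_iff_mem, hqv, h0, map_zero]
    have := I.add_mem h1 hn
    rwa [zero_sub, ← sub_eq_add_neg] at this

theorem d_d (F : Resolution I) (i : ℕ) (x) : F.d i (F.d (i + 1) x) = 0 :=
  (F.exact_succ i _).2 ⟨x, rfl⟩

theorem aug_d (F : Resolution I) (x) : F.aug (F.d 0 x) = 0 :=
  (F.exact_zero _).2 ⟨x, rfl⟩

/-- The comparison theorem, read in homological degree `i`: degree-preserving chain maps
`φ : F → G` and `ψ : G → F` over the identity of `R/I`, and a homotopy `h` from `1` to `ψφ`.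
The last clause holds because `ψφ - 1 - dh` factors through the differential of `F`. -/
theorem exists_comparison (F G : Resolution I)
    (hI : ∀ p ∈ I, ∀ n, MvPolynomial.homogeneousComponent n p ∈ I) (i : ℕ) :
    ∃ (φ : (F.ι i → MvPolynomial V K) →ₗ[MvPolynomial V K] (G.ι i → MvPolynomial V K))
      (ψ : (G.ι i → MvPolynomial V K) →ₗ[MvPolynomial V K] (F.ι i → MvPolynomial V K))
      (h : (F.ι i → MvPolynomial V K) →ₗ[MvPolynomial V K] (F.ι (i + 1) → MvPolynomial V K)),
      IsGradedMap (F.deg i) (G.deg i) φ ∧ IsGradedMap (G.deg i) (F.deg i) ψ ∧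
      (∀ x, ∃ y, G.d i y = φ (F.d i x)) ∧ (∀ x, ∃ y, F.d i y = ψ (G.d i x)) ∧
      (∀ x, ψ (φ (F.d i x)) - F.d i x - F.d i (h (F.d i x)) = 0) ∧
      ∀ x, F.BoundaryMem i x →
        ∀ a, (ψ (φ x) - x - F.d i (h x)) a ∈ MvPolynomial.idealOfVars V K := by
  classical
  induction i with
  | zero =>
    obtain ⟨φ, hφ, hφ'⟩ := exists_lift G.aug F.aug (fun a w => IsHomog (G.deg 0) (F.deg 0 a) w)
      fun a => G.exists_homog_aug_eq hI (F.aug_graded _ _ (isHomog_single _ a))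
    obtain ⟨ψ, hψ, hψ'⟩ := exists_lift F.aug G.aug (fun a w => IsHomog (F.deg 0) (G.deg 0 a) w)
      fun a => F.exists_homog_aug_eq hI (G.aug_graded _ _ (isHomog_single _ a))
    obtain ⟨h, -, hh⟩ := exists_lift (F.d 0) (ψ ∘ₗ φ - LinearMap.id) (fun _ _ => True) (fun a => by
      simp only [true_and]
      exact (F.exact_zero _).1 (by simp [hφ', hψ']))
    refine ⟨φ, ψ, h, isGradedMap_of_single hφ, isGradedMap_of_single hψ, fun x => ?_, fun x => ?_,
      fun x => ?_, fun x _ a => ?_⟩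
    · exact (G.exact_zero _).1 (by rw [hφ', F.aug_d])
    · exact (F.exact_zero _).1 (by rw [hψ', G.aug_d])
    · simp [hh]
    · simp [hh]
  | succ i ih =>
    obtain ⟨φ₀, ψ₀, h₀, gφ, gψ, cφ, cψ, ch, -⟩ := ih
    obtain ⟨φ, hφ, hφ'⟩ := exists_lift (G.d i) (φ₀ ∘ₗ F.d i)
      (fun a w => IsHomog (G.deg (i + 1)) (F.deg (i + 1) a) w)
      fun a => G.exists_homog_d_eq (gφ _ _ (F.d_graded _ _ _ (isHomog_single _ a))) (cφ _)
    obtain ⟨ψ, hψ, hψ'⟩ := exists_lift (F.d i) (ψ₀ ∘ₗ G.d i)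
      (fun a w => IsHomog (F.deg (i + 1)) (G.deg (i + 1) a) w)
      fun a => F.exists_homog_d_eq (gψ _ _ (G.d_graded _ _ _ (isHomog_single _ a))) (cψ _)
    obtain ⟨h, -, hh⟩ := exists_lift (F.d (i + 1)) (ψ ∘ₗ φ - LinearMap.id - h₀ ∘ₗ F.d i)
      (fun _ _ => True) (fun a => by
        simp only [true_and]
        exact (F.exact_succ i _).1 (by
          simpa [hφ', hψ'] using ch (Pi.single a 1)))
    refine ⟨φ, ψ, h, isGradedMap_of_single hφ, isGradedMap_of_single hψ, fun x => ?_, fun x => ?_,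
      fun x => ?_, fun x hx a => ?_⟩
    · exact (G.exact_succ i _).1 (by simp [hφ', F.d_d])
    · exact (F.exact_succ i _).1 (by simp [hψ', G.d_d])
    · simp [hh, F.d_d]
    · have : ψ (φ x) - x - F.d (i + 1) (h x) = h₀ (F.d i x) := by simp [hh]
      rw [this]
      exact Ideal.map_pi _ _ hx _ _

/-- A homogeneous element of `F_i` that gives a nonzero class in the homology of `F ⊗ K`, that is,
in `Tor_i(R/I, K)`, forces a basis element of its degree in `G_i`, for every graded free
resolution `G`. -/
theorem exists_deg_eq (F G : Resolution I)
    (hI : ∀ p ∈ I, ∀ n, MvPolynomial.homogeneousComponent n p ∈ I) {i n : ℕ}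
    {e : F.ι i → MvPolynomial V K} (he : IsHomog (F.deg i) n e) (hd : F.BoundaryMem i e)
    (hb : ∀ y, ∃ a, (e - F.d i y) a ∉ MvPolynomial.idealOfVars V K) :
    ∃ a, G.deg i a = n := by
  by_contra! hG
  obtain ⟨φ, ψ, h, gφ, -, -, -, -, H⟩ := F.exists_comparison G hI i
  obtain ⟨a, ha⟩ := hb (-(h e))
  refine ha ?_
  have h1 : ψ (φ e) a ∈ MvPolynomial.idealOfVars V K :=
    Ideal.map_pi _ _ (fun b => (gφ _ _ he).mem_idealOfVars (hG b)) _ _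
  have h2 := sub_mem h1 (H e hd a)
  have h3 : ψ (φ e) a - (ψ (φ e) - e - F.d i (h e)) a = (e - F.d i (-(h e))) a := by
    simp only [Pi.sub_apply, map_neg, Pi.neg_apply]
    ring
  rwa [h3] at h2

/-- `exists_deg_eq` for a basis element that is a cycle modulo `𝔪` and that occurs in no boundary
with a coefficient outside `𝔪`. -/
theorem exists_deg_eq_of_basis (F G : Resolution I)
    (hI : ∀ p ∈ I, ∀ n, MvPolynomial.homogeneousComponent n p ∈ I) {i : ℕ} {_ : DecidableEq (F.ι i)}
    {b : F.ι i} (hd : F.BoundaryMem i (Pi.single b 1))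
    (hb : ∀ y, F.d i y b ∈ MvPolynomial.idealOfVars V K) :
    ∃ a, G.deg i a = F.deg i b := by
  refine F.exists_deg_eq G hI (isHomog_single _ b) hd fun y => ⟨b, fun h => ?_⟩
  have h1 := add_mem h (hb y)
  rw [Pi.sub_apply, sub_add_cancel, Pi.single_eq_same, mem_idealOfVars_iff] at h1
  simp at h1

end Resolution

/-! ### Existence of minimal graded free resolutions -/

section Existence

variable {V K : Type*} [Field K] {κ : Type*}

/-- The submodule contains the homogeneous components of its elements. -/
def IsGradedSubmodule (deg : κ → ℕ)
    (N : Submodule (MvPolynomial V K) (κ → MvPolynomial V K)) : Prop :=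
  ∀ v ∈ N, ∀ n, comp deg n v ∈ N

/-- `N` is generated by `s` homogeneous elements. -/
def HasHomogGenerators (deg : κ → ℕ)
    (N : Submodule (MvPolynomial V K) (κ → MvPolynomial V K)) (s : ℕ) : Prop :=
  ∃ (g : Fin s → κ → MvPolynomial V K) (e : Fin s → ℕ),
    (∀ a, IsHomog deg (e a) (g a)) ∧ Submodule.span _ (Set.range g) = N

theorem exists_hasHomogGenerators [Finite V] [Fintype κ] {deg : κ → ℕ}
    {N : Submodule (MvPolynomial V K) (κ → MvPolynomial V K)} (hN : IsGradedSubmodule deg N) :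
    ∃ s, HasHomogGenerators deg N s := by
  classical
  obtain ⟨S, hS⟩ : N.FG := IsNoetherian.noetherian N
  choose B hB using exists_sum_comp (V := V) (K := K) deg
  let T : Finset ((κ → MvPolynomial V K) × ℕ) :=
    S.biUnion fun v => (Finset.range (B v)).image fun n => (v, n)
  have hT : ∀ p, p ∈ T ↔ p.1 ∈ S ∧ p.2 < B p.1 := by
    rintro ⟨v, n⟩
    simp only [T, Finset.mem_biUnion, Finset.mem_image, Finset.mem_range, Prod.mk.injEq]
    constructor
    · rintro ⟨v, hv, n, hn, rfl, rfl⟩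
      exact ⟨hv, hn⟩
    · rintro ⟨hv, hn⟩
      exact ⟨v, hv, n, hn, rfl, rfl⟩
  refine ⟨T.card, fun a => comp deg (T.equivFin.symm a).1.2 (T.equivFin.symm a).1.1,
    fun a => (T.equivFin.symm a).1.2, fun a => isHomog_comp _ _ _, le_antisymm ?_ ?_⟩
  · rw [Submodule.span_le]
    rintro _ ⟨a, rfl⟩
    refine hN _ ?_ _
    rw [← hS]
    exact Submodule.subset_span ((hT _).1 (T.equivFin.symm a).2).1
  · rw [← hS, Submodule.span_le]
    intro v hv
    rw [SetLike.mem_coe, hB v]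
    refine Submodule.sum_mem _ fun n hn => Submodule.subset_span ?_
    have hp : (v, n) ∈ T := (hT _).2 ⟨hv, Finset.mem_range.1 hn⟩
    exact ⟨T.equivFin ⟨(v, n), hp⟩, by simp⟩

/-- A graded submodule of a graded free module has a minimal free cover: taking a generating set
of minimal cardinality, a relation with a coefficient outside `𝔪` would express one homogeneous
generator by the others. -/
theorem exists_minimal_cover [Finite V] [Fintype κ] {deg : κ → ℕ}
    {N : Submodule (MvPolynomial V K) (κ → MvPolynomial V K)} (hN : IsGradedSubmodule deg N) :
    ∃ (s : ℕ) (e : Fin s → ℕ)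
      (f : (Fin s → MvPolynomial V K) →ₗ[MvPolynomial V K] (κ → MvPolynomial V K)),
      IsGradedMap e deg f ∧ LinearMap.range f = N ∧
      ∀ c, f c = 0 → ∀ a, c a ∈ MvPolynomial.idealOfVars V K := by
  classical
  have hex := exists_hasHomogGenerators hN
  obtain ⟨s, hs, hmin⟩ : ∃ s, HasHomogGenerators deg N s ∧
      ∀ t, t < s → ¬ HasHomogGenerators deg N t :=
    ⟨Nat.find hex, Nat.find_spec hex, fun t ht => Nat.find_min hex ht⟩
  obtain ⟨g, e, hg, hspan⟩ := hs
  let f := Fintype.linearCombination (MvPolynomial V K) g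
  have hf : ∀ c, f c = ∑ a, c a • g a := fun c => Fintype.linearCombination_apply _ _ _
  have hfe : ∀ a, f (Pi.single a 1) = g a := by
    intro a
    simp [f]
  have gf : IsGradedMap e deg f := isGradedMap_of_single fun a => by rw [hfe]; exact hg a
  refine ⟨s, e, f, gf, by rw [← hspan, ← Fintype.range_linearCombination], fun c hc a => ?_⟩
  rw [mem_idealOfVars_iff]
  by_contra h0
  obtain ⟨s, rfl⟩ : ∃ t, s = t + 1 := ⟨s - 1, by have := a.pos; omega⟩
  -- The component of degree `e a` of the relation has a nonzero constant at `a`.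
  have hc' : f (comp e (e a) c) = 0 := by rw [gf.comp_apply, hc, map_zero]
  have hu : comp e (e a) c a = MvPolynomial.C ((c a).coeff 0) := by
    ext m
    rw [coeff_comp, MvPolynomial.coeff_C]
    by_cases hm : m = 0
    · simp [hm]
    · have : m.degree ≠ 0 := (Finsupp.degree_eq_zero_iff m).not.2 hm
      simp [this, Ne.symm hm]
  rw [hf, Fin.sum_univ_succAbove _ a, hu] at hc'
  have hga : g a ∈ Submodule.span (MvPolynomial V K) (Set.range (g ∘ a.succAbove)) := by
    have h1 : (MvPolynomial.C ((c a).coeff 0) : MvPolynomial V K) • g a ∈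
        Submodule.span (MvPolynomial V K) (Set.range (g ∘ a.succAbove)) := by
      rw [eq_neg_of_add_eq_zero_left hc']
      exact Submodule.neg_mem _ (Submodule.sum_mem _ fun b _ =>
        Submodule.smul_mem _ _ (Submodule.subset_span ⟨b, rfl⟩))
    have h2 := Submodule.smul_mem _ (MvPolynomial.C ((c a).coeff 0)⁻¹) h1
    rwa [smul_smul, ← map_mul, inv_mul_cancel₀ h0, map_one, one_smul] at h2
  refine hmin s (Nat.lt_succ_self s) ⟨g ∘ a.succAbove, e ∘ a.succAbove, fun b => hg _, ?_⟩
  rw [← hspan]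
  refine le_antisymm (Submodule.span_mono (Set.range_comp_subset_range _ _)) ?_
  rw [Submodule.span_le]
  rintro _ ⟨b, rfl⟩
  rcases Fin.eq_self_or_eq_succAbove a b with rfl | ⟨j, rfl⟩
  · exact hga
  · exact Submodule.subset_span ⟨j, rfl⟩

/-- A graded submodule of `𝔪 F`, `F` graded free of finite rank: a module of syzygies in a minimal
resolution. -/
structure Syzygy (V K : Type*) [Field K] where
  rank : ℕ
  deg : Fin rank → ℕ
  N : Submodule (MvPolynomial V K) (Fin rank → MvPolynomial V K)
  graded : IsGradedSubmodule deg N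
  minimal : ∀ v ∈ N, ∀ a, v a ∈ MvPolynomial.idealOfVars V K

theorem Syzygy.exists_next [Finite V] (S : Syzygy V K) :
    ∃ (S' : Syzygy V K)
      (f : (Fin S'.rank → MvPolynomial V K) →ₗ[MvPolynomial V K] (Fin S.rank → MvPolynomial V K)),
      IsGradedMap S'.deg S.deg f ∧ LinearMap.range f = S.N ∧ LinearMap.ker f = S'.N := by
  obtain ⟨s, e, f, gf, hr, hk⟩ := exists_minimal_cover S.graded
  refine ⟨⟨s, e, LinearMap.ker f, fun v hv n => ?_, fun v hv => hk v hv⟩, f, gf, hr, rfl⟩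
  rw [LinearMap.mem_ker] at hv ⊢
  rw [gf.comp_apply, hv, map_zero]

/-- Homogeneous ideals contained in `𝔪` have minimal graded free resolutions. -/
theorem nonempty_minimalGradedFreeResolution [Finite V] {I : Ideal (MvPolynomial V K)}
    (hI : ∀ p ∈ I, ∀ n, MvPolynomial.homogeneousComponent n p ∈ I)
    (hm : I ≤ MvPolynomial.idealOfVars V K) : Nonempty (MinimalGradedFreeResolution I) := by
  choose next f gf hr hk using Syzygy.exists_next (V := V) (K := K)
  let aug : (Fin 1 → MvPolynomial V K) →ₗ[MvPolynomial V K] (MvPolynomial V K ⧸ I) :=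
    (Submodule.mkQ I) ∘ₗ LinearMap.proj 0
  have haug : ∀ v, aug v = Ideal.Quotient.mk I (v 0) := fun v => rfl
  have hcomp : ∀ (v : Fin 1 → MvPolynomial V K) n,
      comp (fun _ : Fin 1 => 0) n v 0 = MvPolynomial.homogeneousComponent n (v 0) := by
    intro v n
    simp [comp]
  let S₀ : Syzygy V K :=
    { rank := 1
      deg := fun _ => 0
      N := LinearMap.ker aug
      graded := by
        intro v hv n
        rw [LinearMap.mem_ker, haug, Ideal.Quotient.eq_zero_iff_mem] at hv ⊢
        rw [hcomp]
        exact hI _ hv n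
      minimal := by
        intro v hv a
        rw [LinearMap.mem_ker, haug, Ideal.Quotient.eq_zero_iff_mem] at hv
        rw [Subsingleton.elim a 0]
        exact hm hv }
  let S : ℕ → Syzygy V K := fun i => Nat.rec S₀ (fun _ => next) i
  have exact_of : ∀ i, LinearMap.range (f (S i)) = (S i).N := fun i => hr _
  exact ⟨{
    rank := fun i => (S i).rank
    deg := fun i => (S i).deg
    aug := aug
    d := fun i => f (S i)
    aug_graded := by
      intro n v hv
      refine ⟨v 0, ?_, rfl⟩
      rw [← IsHomog.comp_self (deg := fun _ : Fin 1 => 0) (n := n) (v := v) hv, hcomp]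
      exact MvPolynomial.homogeneousComponent_isHomogeneous _ _
    d_graded := fun i => gf (S i)
    aug_surjective := by
      intro x
      obtain ⟨p, rfl⟩ := Ideal.Quotient.mk_surjective x
      exact ⟨fun _ => p, rfl⟩
    exact_zero := by
      rw [LinearMap.exact_iff]
      exact (hr S₀).symm
    exact_succ := by
      intro i
      rw [LinearMap.exact_iff]
      exact (hk (S i)).trans (hr (S (i + 1))).symm
    minimal := by
      intro i v
      refine (S i).minimal _ ?_
      rw [← exact_of i]
      exact ⟨v, rfl⟩ }⟩

end Existence

/-! ### The simplicial boundary -/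

section Simplex

variable {E K : Type*} [LinearOrder E] [Field K]

/-- The sign `(-1)^#{b ∈ B | b < a}` of the face `B` of `B ∪ {a}`. -/
def sgn (K : Type*) [Field K] (a : E) (B : Finset E) : K := (-1) ^ (B.filter (· < a)).card

theorem sgn_eq_one {a : E} {B : Finset E} (h : ∀ b ∈ B, a ≤ b) : sgn K a B = 1 := by
  have : B.filter (· < a) = ∅ := Finset.filter_eq_empty_iff.2 fun b hb => not_lt.2 (h b hb)
  simp [sgn, this]

theorem sgn_insert_of_lt {a b : E} {B : Finset E} (hb : b ∉ B) (h : b < a) :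
    sgn K a (insert b B) = -sgn K a B := by
  rw [sgn, sgn, Finset.filter_insert, if_pos h, Finset.card_insert_of_notMem (by simp [hb]),
    pow_succ]
  ring

theorem sgn_insert_of_gt {a b : E} {B : Finset E} (h : a < b) :
    sgn K a (insert b B) = sgn K a B := by
  rw [sgn, sgn, Finset.filter_insert, if_neg (not_lt.2 h.le)]

theorem sgn_mul_sgn_insert {a b : E} {B : Finset E} (hab : a ≠ b) (ha : a ∉ B) (hb : b ∉ B) :
    sgn K a B * sgn K b (insert a B) = -(sgn K b B * sgn K a (insert b B)) := by
  rcases lt_or_gt_of_ne hab with h | h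
  · rw [sgn_insert_of_lt ha h, sgn_insert_of_gt h]
    ring
  · rw [sgn_insert_of_lt hb h, sgn_insert_of_gt h]
    ring

variable [Fintype E]

/-- The boundary of a chain of the full simplex on `E`; a chain is its family of coefficients,
indexed by all faces. -/
def bdry (c : Finset E → K) (B : Finset E) : K :=
  ∑ a ∈ Bᶜ, sgn K a B * c (insert a B)

/-- The cone over a chain with apex `a`: the face `B` goes to `B ∪ {a}` if `a ∉ B`, and to zero
otherwise. -/
def cone (a : E) (c : Finset E → K) (B : Finset E) : K :=
  if a ∈ B then c (B.erase a) else 0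

theorem bdry_bdry (c : Finset E → K) : bdry (bdry c) = 0 := by
  funext B
  simp only [bdry, Finset.mul_sum, Pi.zero_apply]
  rw [Finset.sum_sigma']
  refine Finset.sum_involution (fun p _ => ⟨p.2, p.1⟩) ?_ ?_ ?_ ?_
  · rintro ⟨a, b⟩ h
    simp only [Finset.mem_sigma, Finset.mem_compl, Finset.mem_insert, not_or] at h
    simp only [← mul_assoc]
    rw [sgn_mul_sgn_insert (Ne.symm h.2.1) h.1 h.2.2, Finset.insert_comm b a B]
    ring
  · rintro ⟨a, b⟩ h _ heq
    simp only [Finset.mem_sigma, Finset.mem_compl, Finset.mem_insert, not_or] at h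
    simp only [Sigma.mk.injEq] at heq
    exact h.2.1 heq.1
  · rintro ⟨a, b⟩ h
    simp only [Finset.mem_sigma, Finset.mem_compl, Finset.mem_insert, not_or] at h ⊢
    exact ⟨h.2.2, Ne.symm h.2.1, h.1⟩
  · rintro ⟨a, b⟩ h
    rfl

theorem bdry_cone {c : Finset E → K} (hc : bdry c = 0) {a : E}
    (ha : ∀ B, c B ≠ 0 → ∀ b ∈ B, a ≤ b) : bdry (cone a c) = c := by
  funext B
  by_cases hB : a ∈ B
  · have h0 := congrFun hc (B.erase a)
    have hcompl : (B.erase a)ᶜ = insert a Bᶜ := by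
      ext x
      simp only [Finset.mem_compl, Finset.mem_erase, Finset.mem_insert]
      tauto
    have haB : sgn K a (B.erase a) * c B = c B := by
      by_cases h : c B = 0
      · simp [h]
      · rw [sgn_eq_one fun b hb => ha B h b (Finset.mem_of_mem_erase hb), one_mul]
    rw [bdry, hcompl, Finset.sum_insert (by simpa using hB), Finset.insert_erase hB, haB,
      Pi.zero_apply] at h0
    rw [eq_neg_of_add_eq_zero_left h0, bdry, ← Finset.sum_neg_distrib]
    refine Finset.sum_congr rfl fun x hx => ?_
    rw [Finset.mem_compl] at hx
    have hxa : x ≠ a := fun h => hx (h ▸ hB)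
    rw [cone, if_pos (Finset.mem_insert_of_mem hB), Finset.erase_insert_of_ne hxa]
    by_cases h : c (insert x (B.erase a)) = 0
    · simp [h]
    · have hlt : a < x :=
        lt_of_le_of_ne (ha _ h x (Finset.mem_insert_self _ _)) (Ne.symm hxa)
      have hs : sgn K x B = -sgn K x (B.erase a) := by
        conv_lhs => rw [← Finset.insert_erase hB]
        exact sgn_insert_of_lt (Finset.notMem_erase _ _) hlt
      rw [hs]
      ring
  · rw [bdry, Finset.sum_eq_single a]
    · rw [cone, if_pos (Finset.mem_insert_self _ _), Finset.erase_insert hB]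
      by_cases h : c B = 0
      · simp [h]
      · rw [sgn_eq_one (ha B h), one_mul]
    · intro x _ hxa
      rw [cone, if_neg, mul_zero]
      rw [Finset.mem_insert, not_or]
      exact ⟨Ne.symm hxa, hB⟩
    · intro h
      exact absurd (Finset.mem_compl.2 hB) h

end Simplex

/-! ### The Taylor complex -/

section Taylor

variable {V E K : Type*} [Field K]

/-- The monomial ideal generated by the monomials with exponents `m a`. -/
noncomputable def monomialIdeal (K : Type*) [Field K] (m : E → V →₀ ℕ) : Ideal (MvPolynomial V K) :=
  Ideal.span ((fun s => MvPolynomial.monomial s (1 : K)) '' Set.range m)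

theorem mem_monomialIdeal_iff {m : E → V →₀ ℕ} {p : MvPolynomial V K} :
    p ∈ monomialIdeal K m ↔ ∀ s ∈ p.support, ∃ a, m a ≤ s := by
  simp [monomialIdeal, MvPolynomial.mem_ideal_span_monomial_image]

theorem homogeneousComponent_mem_monomialIdeal {m : E → V →₀ ℕ} {p : MvPolynomial V K}
    (hp : p ∈ monomialIdeal K m) (n : ℕ) :
    MvPolynomial.homogeneousComponent n p ∈ monomialIdeal K m := by
  rw [mem_monomialIdeal_iff] at hp ⊢
  intro s hs
  refine hp s ?_
  rw [MvPolynomial.mem_support_iff, MvPolynomial.coeff_homogeneousComponent] at hs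
  rw [MvPolynomial.mem_support_iff]
  intro h
  simp [h] at hs

/-- The part of multidegree `μ` of the vector `z` of `⨁_B R(-lcm B)`, as a chain of the full
simplex: the coefficients of the monomials `x^(μ - lcm B)` in `z B`. -/
noncomputable def multipart (m : E → V →₀ ℕ) (z : Finset E → MvPolynomial V K) (μ : V →₀ ℕ)
    (B : Finset E) : K :=
  open Classical in if B.sup m ≤ μ then (z B).coeff (μ - B.sup m) else 0

theorem multipart_add_sup (m : E → V →₀ ℕ) (z : Finset E → MvPolynomial V K) (s : V →₀ ℕ)
    (B : Finset E) : multipart m z (s + B.sup m) B = (z B).coeff s := by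
  rw [multipart, if_pos (by simp), add_tsub_cancel_right]

theorem ext_multipart {m : E → V →₀ ℕ} {z w : Finset E → MvPolynomial V K}
    (h : ∀ μ, multipart m z μ = multipart m w μ) : z = w := by
  ext B s
  rw [← multipart_add_sup m, h, multipart_add_sup]

variable [LinearOrder E]

theorem sup_le_of_erase {m : E → V →₀ ℕ} {a : E} {B : Finset E} {μ : V →₀ ℕ}
    (ha : m a ≤ μ) (hB : (B.erase a).sup m ≤ μ) : B.sup m ≤ μ := by
  refine Finset.sup_le fun b hb => ?_
  by_cases h : b = a
  · exact h ▸ ha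
  · exact (Finset.le_sup (Finset.mem_erase.2 ⟨h, hb⟩)).trans hB

/-- `a` is the least index of a generator that divides `x^μ`. -/
def IsLeastDivisor (m : E → V →₀ ℕ) (a : E) (μ : V →₀ ℕ) : Prop :=
  m a ≤ μ ∧ ∀ b, m b ≤ μ → a ≤ b

/-- The contraction of the Taylor complex: in multidegree `μ`, the cone whose apex is the least
index of a generator dividing `x^μ`. -/
noncomputable def taylorCone (m : E → V →₀ ℕ) (z : Finset E → MvPolynomial V K) (B : Finset E) :
    MvPolynomial V K :=
  open Classical in
  ∑ a ∈ B, ∑ ν ∈ (z (B.erase a)).support,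
    if IsLeastDivisor m a (ν + (B.erase a).sup m) then
      MvPolynomial.monomial (ν + (B.erase a).sup m - B.sup m) ((z (B.erase a)).coeff ν) else 0

open Classical in
theorem multipart_taylorCone (m : E → V →₀ ℕ) (z : Finset E → MvPolynomial V K) (μ : V →₀ ℕ)
    (B : Finset E) : multipart m (taylorCone m z) μ B =
      ∑ a ∈ B, if IsLeastDivisor m a μ then multipart m z μ (B.erase a) else 0 := by
  rw [multipart]
  split_ifs with h
  · rw [taylorCone, MvPolynomial.coeff_sum]
    refine Finset.sum_congr rfl fun a _ => ?_
    rw [MvPolynomial.coeff_sum]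
    have key : ∀ ν, MvPolynomial.coeff (μ - B.sup m)
        (if IsLeastDivisor m a (ν + (B.erase a).sup m) then
          MvPolynomial.monomial (ν + (B.erase a).sup m - B.sup m) ((z (B.erase a)).coeff ν)
          else 0) =
        if ν + (B.erase a).sup m = μ then
          (if IsLeastDivisor m a μ then (z (B.erase a)).coeff ν else 0) else 0 := by
      intro ν
      by_cases h1 : ν + (B.erase a).sup m = μ
      · rw [h1, if_pos rfl]
        split_ifs <;> simp
      · rw [if_neg h1]
        split_ifs with h2
        · have h3 : B.sup m ≤ ν + (B.erase a).sup m := sup_le_of_erase h2.1 (by simp)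
          rw [MvPolynomial.coeff_monomial, if_neg]
          intro h4
          exact h1 ((tsub_left_inj h3 h).1 h4)
        · simp
    rw [Finset.sum_congr rfl fun ν _ => key ν]
    by_cases h2 : IsLeastDivisor m a μ
    · simp only [if_pos h2]
      rw [multipart]
      split_ifs with h3
      · have h4 : ∀ ν, ν + (B.erase a).sup m = μ ↔ ν = μ - (B.erase a).sup m := fun ν =>
          ⟨fun h => by rw [← h, add_tsub_cancel_right], fun h => by rw [h, tsub_add_cancel_of_le h3]⟩
        simp only [h4]
        rw [Finset.sum_ite_eq']
        split_ifs with h5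
        · rfl
        · exact (MvPolynomial.notMem_support_iff.1 h5).symm
      · refine Finset.sum_eq_zero fun ν _ => if_neg fun h4 => h3 ?_
        rw [← h4]
        simp
    · simp [h2]
  · symm
    refine Finset.sum_eq_zero fun a _ => ?_
    split_ifs with h1
    · rw [multipart, if_neg fun h2 => h (sup_le_of_erase h1.1 h2)]
    · rfl

variable [Fintype E]

/-- The Taylor differential, on the sum over all homological degrees. -/
noncomputable def taylorD (m : E → V →₀ ℕ) : (Finset E → MvPolynomial V K) →ₗ[MvPolynomial V K]
    (Finset E → MvPolynomial V K) :=
  LinearMap.pi fun B => ∑ a ∈ Bᶜ,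
    MvPolynomial.monomial ((insert a B).sup m - B.sup m) (sgn K a B) • LinearMap.proj (insert a B)

theorem taylorD_apply (m : E → V →₀ ℕ) (z : Finset E → MvPolynomial V K) (B : Finset E) :
    taylorD m z B = ∑ a ∈ Bᶜ,
      MvPolynomial.monomial ((insert a B).sup m - B.sup m) (sgn K a B) * z (insert a B) := by
  simp [taylorD]

theorem multipart_taylorD (m : E → V →₀ ℕ) (z : Finset E → MvPolynomial V K) (μ : V →₀ ℕ) :
    multipart m (taylorD m z) μ = bdry (multipart m z μ) := by
  funext B
  rw [bdry, multipart]
  have hle : ∀ a, B.sup m ≤ (insert a B).sup m :=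
    fun a => Finset.sup_mono (Finset.subset_insert _ _)
  split_ifs with h
  · rw [taylorD_apply, MvPolynomial.coeff_sum]
    refine Finset.sum_congr rfl fun a _ => ?_
    rw [MvPolynomial.coeff_monomial_mul', multipart]
    have h1 : (insert a B).sup m - B.sup m ≤ μ - B.sup m ↔ (insert a B).sup m ≤ μ := by
      rw [tsub_le_iff_right, tsub_add_cancel_of_le h]
    by_cases h2 : (insert a B).sup m ≤ μ
    · rw [if_pos (h1.2 h2), if_pos h2, tsub_tsub, add_tsub_cancel_of_le (hle a)]
    · rw [if_neg (mt h1.1 h2), if_neg h2, mul_zero]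
  · symm
    refine Finset.sum_eq_zero fun a _ => ?_
    rw [multipart, if_neg fun h' => h ((hle a).trans h'), mul_zero]

theorem taylorD_taylorD (m : E → V →₀ ℕ) (z : Finset E → MvPolynomial V K) :
    taylorD m (taylorD m z) = 0 := by
  refine ext_multipart (m := m) fun μ => ?_
  rw [multipart_taylorD, multipart_taylorD, bdry_bdry]
  funext B
  simp [multipart]

/-- Exactness of the Taylor complex: a cycle is a boundary if each of its multidegrees is divisible
by a generator, so that the apex of the cone exists. -/
theorem exists_taylorD_eq {m : E → V →₀ ℕ} {z : Finset E → MvPolynomial V K}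
    (hz : taylorD m z = 0) (h : ∀ μ B, multipart m z μ B ≠ 0 → ∃ a, m a ≤ μ) :
    ∃ w, taylorD m w = z := by
  classical
  refine ⟨taylorCone m z, ext_multipart (m := m) fun μ => ?_⟩
  rw [multipart_taylorD]
  by_cases hμ : ∃ a, m a ≤ μ
  · obtain ⟨a, ha⟩ : ∃ a, IsLeastDivisor m a μ := by
      have hne : (Finset.univ.filter fun a => m a ≤ μ).Nonempty := by
        obtain ⟨a, ha⟩ := hμ
        exact ⟨a, by simp [ha]⟩
      refine ⟨Finset.min' _ hne, ?_, fun b hb => Finset.min'_le _ _ (by simp [hb])⟩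
      simpa using Finset.min'_mem _ hne
    have hcone : multipart m (taylorCone m z) μ = cone a (multipart m z μ) := by
      funext B
      rw [multipart_taylorCone]
      have huniq : ∀ b, IsLeastDivisor m b μ ↔ b = a := fun b =>
        ⟨fun hb => le_antisymm (hb.2 a ha.1) (ha.2 b hb.1), fun hb => hb ▸ ha⟩
      simp only [huniq]
      rw [Finset.sum_ite_eq', cone]
    rw [hcone]
    refine bdry_cone ?_ fun B hB b hb => ha.2 b ?_
    · rw [← multipart_taylorD, hz]
      funext B
      simp [multipart]
    · rw [multipart] at hB
      split_ifs at hB with h1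
      · exact (Finset.le_sup hb).trans h1
      · exact absurd rfl hB
  · have h0 : multipart m z μ = 0 := by
      funext B
      by_contra h0
      exact hμ (h μ B h0)
    have h1 : multipart m (taylorCone m z) μ = 0 := by
      funext B
      rw [multipart_taylorCone]
      simp [h0]
    rw [h0, h1]
    funext B
    simp [bdry]

end Taylor

section TaylorResolution

variable {V E K : Type*} [Field K]

/-- Extension by zero of a vector indexed by the `i`-element sets. -/
noncomputable def extendZero (K : Type*) [Field K] (i : ℕ) :
    ({A : Finset E // A.card = i} → MvPolynomial V K) →ₗ[MvPolynomial V K]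
      (Finset E → MvPolynomial V K) :=
  LinearMap.pi fun A => if h : A.card = i then LinearMap.proj ⟨A, h⟩ else 0

/-- Restriction of a vector to the `i`-element sets. -/
noncomputable def restrictCard (K : Type*) [Field K] (i : ℕ) :
    (Finset E → MvPolynomial V K) →ₗ[MvPolynomial V K]
      ({A : Finset E // A.card = i} → MvPolynomial V K) :=
  LinearMap.funLeft _ _ Subtype.val

theorem extendZero_apply {i : ℕ} (z : {A : Finset E // A.card = i} → MvPolynomial V K)
    (A : Finset E) : extendZero K i z A = if h : A.card = i then z ⟨A, h⟩ else 0 := by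
  by_cases h : A.card = i <;> simp [extendZero, h]

theorem extendZero_of_ne {i : ℕ} (z : {A : Finset E // A.card = i} → MvPolynomial V K)
    {A : Finset E} (h : A.card ≠ i) : extendZero K i z A = 0 := by
  simp [extendZero_apply, h]

theorem restrictCard_apply {i : ℕ} (z : Finset E → MvPolynomial V K)
    (A : {A : Finset E // A.card = i}) : restrictCard K i z A = z A.1 := rfl

theorem restrictCard_extendZero {i : ℕ} (z : {A : Finset E // A.card = i} → MvPolynomial V K) :
    restrictCard K i (extendZero K i z) = z := by
  funext A
  rw [restrictCard_apply, extendZero_apply, dif_pos A.2]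

variable [LinearOrder E] [Fintype E]

/-- The Taylor differential in homological degree `i + 1`. -/
noncomputable def taylorDiff (m : E → V →₀ ℕ) (i : ℕ) :
    ({A : Finset E // A.card = i + 1} → MvPolynomial V K) →ₗ[MvPolynomial V K]
      ({A : Finset E // A.card = i} → MvPolynomial V K) :=
  restrictCard K i ∘ₗ taylorD m ∘ₗ extendZero K (i + 1)

theorem taylorDiff_apply (m : E → V →₀ ℕ) {i : ℕ}
    (z : {A : Finset E // A.card = i + 1} → MvPolynomial V K) (B : {A : Finset E // A.card = i}) :
    taylorDiff m i z B = taylorD m (extendZero K (i + 1) z) B.1 := rfl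

theorem extendZero_taylorDiff (m : E → V →₀ ℕ) {i : ℕ}
    (z : {A : Finset E // A.card = i + 1} → MvPolynomial V K) :
    extendZero K i (taylorDiff m i z) = taylorD m (extendZero K (i + 1) z) := by
  funext B
  rw [extendZero_apply]
  split_ifs with h
  · rfl
  · rw [taylorD_apply]
    refine (Finset.sum_eq_zero fun a ha => ?_).symm
    rw [extendZero_of_ne, mul_zero]
    rw [Finset.card_insert_of_notMem (Finset.mem_compl.1 ha)]
    omega

theorem taylorDiff_restrictCard (m : E → V →₀ ℕ) {i : ℕ} (w : Finset E → MvPolynomial V K) :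
    taylorDiff m i (restrictCard K (i + 1) w) = restrictCard K i (taylorD m w) := by
  funext B
  rw [taylorDiff_apply, restrictCard_apply, taylorD_apply, taylorD_apply]
  refine Finset.sum_congr rfl fun a ha => ?_
  rw [extendZero_apply, dif_pos (by rw [Finset.card_insert_of_notMem (Finset.mem_compl.1 ha), B.2]),
    restrictCard_apply]

theorem taylorD_extendZero_zero (m : E → V →₀ ℕ)
    (z : {A : Finset E // A.card = 0} → MvPolynomial V K) :
    taylorD m (extendZero K 0 z) = 0 := by
  funext B
  rw [taylorD_apply]
  refine Finset.sum_eq_zero fun a _ => ?_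
  rw [extendZero_of_ne _ (by simp), mul_zero]

theorem taylorDiff_graded (m : E → V →₀ ℕ) (i : ℕ) :
    IsGradedMap (fun A : {A : Finset E // A.card = i + 1} => (A.1.sup m).degree)
      (fun A : {A : Finset E // A.card = i} => (A.1.sup m).degree) (taylorDiff (K := K) m i) := by
  intro n v hv B s hs
  rw [MvPolynomial.mem_support_iff, taylorDiff_apply, ← multipart_add_sup m,
    multipart_taylorD, bdry] at hs
  obtain ⟨a, -, ha⟩ := Finset.exists_ne_zero_of_sum_ne_zero hs
  have h1 := right_ne_zero_of_mul ha
  rw [multipart, extendZero_apply] at h1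
  split_ifs at h1 with h2 h3
  · have := hv _ _ (MvPolynomial.mem_support_iff.2 h1)
    simp only [← map_add] at this ⊢
    rwa [tsub_add_cancel_of_le h2] at this
  · simp at h1
  · simp at h1

/-- The Taylor resolution of a monomial ideal. -/
noncomputable def taylorResolution (K : Type*) [Field K] (m : E → V →₀ ℕ) :
    Resolution (monomialIdeal K m) where
  ι i := {A : Finset E // A.card = i}
  fin i := inferInstance
  deg i A := (A.1.sup m).degree
  aug := Submodule.mkQ _ ∘ₗ LinearMap.proj ⟨∅, rfl⟩
  d := taylorDiff m
  aug_graded n v hv := ⟨v ⟨∅, rfl⟩, fun s hs => by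
    have := hv ⟨∅, rfl⟩ s (MvPolynomial.mem_support_iff.2 hs)
    dsimp only at this
    rw [Finset.sup_empty, bot_eq_zero, map_zero, add_zero, Finsupp.degree_eq_weight_one] at this
    exact this, rfl⟩
  d_graded := taylorDiff_graded m
  aug_surjective x := by
    obtain ⟨p, rfl⟩ := Submodule.mkQ_surjective _ x
    exact ⟨fun _ => p, rfl⟩
  exact_zero z := by
    constructor
    · intro hz
      have hz' : z ⟨∅, rfl⟩ ∈ monomialIdeal K m := (Submodule.Quotient.mk_eq_zero _).1 hz
      obtain ⟨w, hw⟩ := exists_taylorD_eq (taylorD_extendZero_zero m z) (fun μ B h => by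
        rw [multipart, extendZero_apply] at h
        split_ifs at h with h1 h2
        · obtain rfl := Finset.card_eq_zero.1 h2
          obtain ⟨a, ha⟩ := mem_monomialIdeal_iff.1 hz' _ (MvPolynomial.mem_support_iff.2 h)
          exact ⟨a, by simpa [bot_eq_zero] using ha⟩
        · simp at h
        · simp at h)
      exact ⟨restrictCard K 1 w, by
        rw [taylorDiff_restrictCard, hw, restrictCard_extendZero]⟩
    · rintro ⟨w, rfl⟩
      refine (Submodule.Quotient.mk_eq_zero _).2 ?_
      change taylorDiff m 0 w ⟨∅, rfl⟩ ∈ _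
      rw [taylorDiff_apply, taylorD_apply]
      refine Ideal.sum_mem _ fun a _ => Ideal.mul_mem_right _ _ ?_
      rw [mem_monomialIdeal_iff]
      intro s hs
      have := MvPolynomial.support_monomial_subset hs
      rw [Finset.mem_singleton] at this
      exact ⟨a, by simp [this, bot_eq_zero]⟩
  exact_succ i z := by
    constructor
    · intro hz
      have h0 : taylorD m (extendZero K (i + 1) z) = 0 := by
        rw [← extendZero_taylorDiff, hz, map_zero]
      obtain ⟨w, hw⟩ := exists_taylorD_eq h0 (fun μ B h => by
        rw [multipart, extendZero_apply] at h
        split_ifs at h with h1 h2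
        · obtain ⟨a, ha⟩ := Finset.card_pos.1 (by omega : 0 < B.card)
          exact ⟨a, (Finset.le_sup ha).trans h1⟩
        · simp at h
        · simp at h)
      exact ⟨restrictCard K (i + 1 + 1) w, by
        rw [taylorDiff_restrictCard, hw, restrictCard_extendZero]⟩
    · rintro ⟨w, rfl⟩
      change taylorDiff m i (taylorDiff m (i + 1) w) = 0
      funext B
      rw [taylorDiff_apply, extendZero_taylorDiff, taylorD_taylorD]
      rfl

theorem coeff_zero_monomial_sub_mul {s t : V →₀ ℕ} (h : t ≤ s) (hne : s ≠ t) (c : K)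
    (p : MvPolynomial V K) : (MvPolynomial.monomial (s - t) c * p).coeff 0 = 0 := by
  rw [MvPolynomial.coeff_monomial_mul', if_neg]
  intro h0
  exact hne (le_antisymm (tsub_eq_zero_iff_le.1 (nonpos_iff_eq_zero.1 h0)) h)

/-- A face `A` of the Taylor complex all of whose facets have a smaller lcm is a cycle
modulo `𝔪`. -/
theorem taylorDiff_single_mem {m : E → V →₀ ℕ} {i : ℕ} {A : {A : Finset E // A.card = i + 1}}
    (hA : ∀ a ∈ A.1, (A.1.erase a).sup m ≠ A.1.sup m) (B : {B : Finset E // B.card = i}) :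
    taylorDiff m i (Pi.single A 1) B ∈ MvPolynomial.idealOfVars V K := by
  rw [mem_idealOfVars_iff, taylorDiff_apply, taylorD_apply, MvPolynomial.coeff_sum]
  refine Finset.sum_eq_zero fun a ha => ?_
  by_cases h : insert a B.1 = A.1
  · refine coeff_zero_monomial_sub_mul (Finset.sup_mono (Finset.subset_insert _ _)) ?_ _ _
    have hB : A.1.erase a = B.1 := by
      rw [← h, Finset.erase_insert (Finset.mem_compl.1 ha)]
    rw [h, ← hB]
    exact (hA a (h ▸ Finset.mem_insert_self _ _)).symm
  · rw [extendZero_apply]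
    split_ifs with h1
    · rw [Pi.single_eq_of_ne (fun h2 => h (congrArg Subtype.val h2))]
      simp
    · simp

/-- A face `A` of the Taylor complex that has no cofacet of the same lcm occurs in no boundary
with a coefficient outside `𝔪`. -/
theorem taylorDiff_apply_mem {m : E → V →₀ ℕ} {i : ℕ} {A : {A : Finset E // A.card = i}}
    (hA : ∀ a ∉ A.1, (insert a A.1).sup m ≠ A.1.sup m)
    (y : {A : Finset E // A.card = i + 1} → MvPolynomial V K) :
    taylorDiff m i y A ∈ MvPolynomial.idealOfVars V K := by
  rw [mem_idealOfVars_iff, taylorDiff_apply, taylorD_apply, MvPolynomial.coeff_sum]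
  exact Finset.sum_eq_zero fun a ha => coeff_zero_monomial_sub_mul
    (Finset.sup_mono (Finset.subset_insert _ _)) (hA a (Finset.mem_compl.1 ha)) _ _

theorem taylorResolution_boundaryMem {m : E → V →₀ ℕ} {i : ℕ} {A : {A : Finset E // A.card = i}}
    (hA : ∀ a ∈ A.1, (A.1.erase a).sup m ≠ A.1.sup m) :
    (taylorResolution K m).BoundaryMem i
      (Pi.single A 1 : {A : Finset E // A.card = i} → MvPolynomial V K) := by
  cases i with
  | zero => trivial
  | succ i => exact taylorDiff_single_mem hA

theorem ofMinimal_boundaryMem {I : Ideal (MvPolynomial V K)} (F : MinimalGradedFreeResolution I)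
    {i : ℕ} (v : Fin (F.rank i) → MvPolynomial V K) : (ofMinimal F).BoundaryMem i v := by
  cases i with
  | zero => trivial
  | succ i => exact F.minimal i v

/-- Regularity of a monomial quotient read off from the Taylor resolution: `r` bounds
`deg lcm A - |A|` for all sets `A` of generators, and is attained by a set `A₀` whose lcm changes
whenever a generator is removed or added. -/
theorem hasRegularity_monomialIdeal [Finite V] {m : E → V →₀ ℕ} (hm : ∀ a, m a ≠ 0) {r : ℕ}
    (hle : ∀ A : Finset E, (A.sup m).degree ≤ A.card + r) {A₀ : Finset E}
    (heq : (A₀.sup m).degree = A₀.card + r)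
    (herase : ∀ a ∈ A₀, (A₀.erase a).sup m ≠ A₀.sup m)
    (hinsert : ∀ a ∉ A₀, (insert a A₀).sup m ≠ A₀.sup m) :
    HasRegularity (monomialIdeal K m) r := by
  have hI : ∀ p ∈ monomialIdeal K m, ∀ n,
      MvPolynomial.homogeneousComponent n p ∈ monomialIdeal K m :=
    fun p hp n => homogeneousComponent_mem_monomialIdeal hp n
  refine ⟨nonempty_minimalGradedFreeResolution hI fun p hp => ?_, fun F => ⟨?_, ?_⟩⟩
  · rw [mem_idealOfVars_iff]
    by_contra h0
    obtain ⟨a, ha⟩ := mem_monomialIdeal_iff.1 hp 0 (MvPolynomial.mem_support_iff.2 h0)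
    exact hm a (nonpos_iff_eq_zero.1 ha)
  · obtain ⟨a, ha⟩ := Resolution.exists_deg_eq_of_basis (taylorResolution K m) (ofMinimal F) hI
      (i := A₀.card) (b := (⟨A₀, rfl⟩ : {A : Finset E // A.card = A₀.card}))
      (hd := taylorResolution_boundaryMem herase)
      (hb := taylorDiff_apply_mem hinsert)
    refine ⟨A₀.card, (A₀.sup m).degree, ?_, ?_⟩
    · rw [MinimalGradedFreeResolution.betti]
      exact Finset.card_ne_zero_of_mem (Finset.mem_filter.2 ⟨Finset.mem_univ a, ha⟩)
    · rw [heq]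
      push_cast
      ring
  · rintro _ ⟨i, j, hij, rfl⟩
    obtain ⟨a, ha⟩ := Finset.card_ne_zero.1 hij
    have haj : F.deg i a = j := (Finset.mem_filter.1 ha).2
    obtain ⟨A, hA⟩ := Resolution.exists_deg_eq_of_basis (ofMinimal F) (taylorResolution K m) hI
      (i := i) (b := (a : Fin (F.rank i)))
      (hd := ofMinimal_boundaryMem F (Pi.single a 1))
      (hb := fun y => F.minimal i y a)
    have h1 := hle A.1
    have h2 : (A.1.sup m).degree = j := hA.trans haj
    have h3 : A.1.card = i := A.2
    omega

end TaylorResolution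

/-! ### Squarefree monomial ideals -/

section Squarefree

variable {V E K : Type*} [Field K]

/-- The exponent of the squarefree monomial `∏_{v ∈ P} x_v`. -/
noncomputable def expo (P : Finset V) : V →₀ ℕ := Finsupp.indicator P fun _ _ => 1

theorem expo_apply [DecidableEq V] (P : Finset V) (v : V) :
    expo P v = if v ∈ P then 1 else 0 := by
  simp [expo, Finsupp.indicator_apply]

theorem expo_injective : Function.Injective (expo : Finset V → V →₀ ℕ) := by
  classical
  intro P Q h
  ext v
  have := DFunLike.congr_fun h v
  rw [expo_apply, expo_apply] at this
  split_ifs at this <;> simp_all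

theorem degree_expo (P : Finset V) : (expo P).degree = P.card := by
  classical
  have hs : (expo P).support = P := by
    ext v
    simp [expo_apply]
  rw [Finsupp.degree_apply, hs, Finset.card_eq_sum_ones]
  exact Finset.sum_congr rfl fun v hv => by rw [expo_apply, if_pos hv]

theorem sup_expo [DecidableEq V] (A : Finset E) (P : E → Finset V) :
    A.sup (fun a => expo (P a)) = expo (A.biUnion P) := by
  classical
  induction A using Finset.induction_on with
  | empty =>
    ext v
    simp [expo_apply, bot_eq_zero]
  | insert a A _ ih =>
    rw [Finset.sup_insert, ih, Finset.biUnion_insert]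
    ext v
    rw [Finsupp.sup_apply, expo_apply, expo_apply, expo_apply]
    by_cases h1 : v ∈ P a <;> by_cases h2 : v ∈ A.biUnion P <;>
      simp only [Finset.mem_union, h1, h2] <;> simp

theorem prod_map_X_eq [DecidableEq V] {p : List V} (hp : p.Nodup) :
    (p.map (MvPolynomial.X : V → MvPolynomial V K)).prod =
      MvPolynomial.monomial (expo p.toFinset) 1 := by
  induction p with
  | nil =>
    have : expo (∅ : Finset V) = 0 := by ext v; simp [expo_apply]
    simp [this]
  | cons a p ih =>
    rw [List.nodup_cons] at hp
    rw [List.map_cons, List.prod_cons, ih hp.2, MvPolynomial.X, MvPolynomial.monomial_mul, mul_one]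
    refine congrArg (fun s => MvPolynomial.monomial s (1 : K)) ?_
    ext v
    rw [Finsupp.add_apply, expo_apply, expo_apply, Finsupp.single_apply]
    by_cases h : a = v
    · subst h
      simp [hp.1]
    · simp [h, Ne.symm h]

/-- `hasRegularity_monomialIdeal` for squarefree monomials, given by their sets of variables. -/
theorem hasRegularity_squarefree [Finite V] [Finite E] [DecidableEq V] [DecidableEq E]
    {P : E → Finset V} (hP : ∀ a, (P a).Nonempty) {r : ℕ}
    (hle : ∀ A : Finset E, (A.biUnion P).card ≤ A.card + r) {A₀ : Finset E}
    (heq : (A₀.biUnion P).card = A₀.card + r)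
    (herase : ∀ a ∈ A₀, (A₀.erase a).biUnion P ≠ A₀.biUnion P)
    (hinsert : ∀ a ∉ A₀, (insert a A₀).biUnion P ≠ A₀.biUnion P) :
    HasRegularity (monomialIdeal K fun a => expo (P a)) r := by
  have := Fintype.ofFinite E
  let : LinearOrder E := LinearOrder.lift' (Fintype.equivFin E) (Fintype.equivFin E).injective
  refine hasRegularity_monomialIdeal (fun a h => ?_) (fun A => ?_) (A₀ := A₀) ?_
    (fun a ha h => herase a ha ?_) (fun a ha h => hinsert a ha ?_)
  · obtain ⟨v, hv⟩ := hP a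
    have := DFunLike.congr_fun h v
    rw [expo_apply, if_pos hv] at this
    simp at this
  · rw [sup_expo, degree_expo]
    exact hle A
  · rw [sup_expo, degree_expo]
    exact heq
  · rw [sup_expo, sup_expo] at h
    convert expo_injective h
  · rw [sup_expo, sup_expo] at h
    convert expo_injective h

end Squarefree

end GradedFree

/-! ### Levels and directed paths in a rooted tree -/

namespace DirectedRootedTree

variable {V : Type*} {T : DirectedRootedTree V}

/-- A vertex has at most one parent, because the path from the root to it is unique. -/
theorem Edge.eq_of_edge {x x' y : V} (h : T.Edge x y) (h' : T.Edge x' y) : x = x' := by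
  have key : ∀ z, T.Edge z y → ∃ p : T.graph.Walk T.root y, p.IsPath ∧ p.penultimate = z := by
    intro z hz
    obtain ⟨p, hp⟩ := T.isTree.connected.exists_walk_length_eq_dist T.root z
    refine ⟨p.concat hz.1, ?_, by simp⟩
    refine SimpleGraph.Walk.isPath_of_length_eq_dist _ ?_
    rw [SimpleGraph.Walk.length_concat, hp]
    exact hz.2.symm
  obtain ⟨p, hp, rfl⟩ := key x h
  obtain ⟨q, hq, rfl⟩ := key x' h'
  rw [(T.isTree.existsUnique_path T.root y).unique hp hq]

theorem exists_edge_of_level_eq_succ {y : V} {n : ℕ} (hy : T.level y = n + 1) :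
    ∃ x, T.Edge x y := by
  obtain ⟨p, hp⟩ := T.isTree.connected.exists_walk_length_eq_dist y T.root
  have hlen : p.length = n + 1 := by
    rw [hp, SimpleGraph.dist_comm]
    exact hy
  cases p with
  | nil => simp at hlen
  | @cons _ x _ hadj q =>
    rw [SimpleGraph.Walk.length_cons] at hlen
    have h1 : T.level x ≤ n := by
      rw [level, SimpleGraph.dist_comm]
      exact (SimpleGraph.dist_le q).trans (by omega)
    have h2 : T.level y ≤ T.level x + 1 := by
      have := T.isTree.connected.dist_triangle (u := T.root) (v := x) (w := y)
      rwa [SimpleGraph.dist_eq_one_iff_adj.2 hadj.symm] at this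
    exact ⟨x, hadj.symm, by omega⟩

theorem level_eq_zero_iff {x : V} : T.level x = 0 ↔ x = T.root := by
  rw [level, T.isTree.connected.dist_eq_zero_iff, eq_comm]

theorem level_getElem {p : List V} (hp : p.IsChain T.Edge) (i : ℕ) (hi : i < p.length) :
    T.level p[i] = T.level (p[0]'(by omega)) + i := by
  induction i with
  | zero => rfl
  | succ i ih =>
    have := (List.isChain_iff_getElem.1 hp i hi).2
    rw [this, ih (by omega)]
    ring

theorem nodup_of_isChain {p : List V} (hp : p.IsChain T.Edge) : p.Nodup := by
  rw [List.nodup_iff_injective_get]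
  intro i j h
  have hi := level_getElem hp i i.2
  have hj := level_getElem hp j j.2
  simp only [List.get_eq_getElem] at h
  rw [h] at hi
  exact Fin.ext (by omega)

/-- A directed path that starts in level `n` extends backwards to the root. The vertex `v` is only
recorded as a member of the result. -/
theorem exists_isChain_to_root (n : ℕ) (v : V) (q : List V) (hv : T.level v = n)
    (hq : (v :: q).IsChain T.Edge) :
    ∃ q' : List V, q'.IsChain T.Edge ∧ q'.length = n + (q.length + 1) ∧ v ∈ q' := by
  suffices H : ∃ q' : List V, q'.IsChain T.Edge ∧ q'.length = n + (q.length + 1) ∧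
      v :: q ⊆ q' by
    obtain ⟨q', h1, h2, h3⟩ := H
    exact ⟨q', h1, h2, h3 List.mem_cons_self⟩
  induction n generalizing v q with
  | zero => exact ⟨v :: q, hq, by simp, List.Subset.refl _⟩
  | succ n ih =>
    obtain ⟨x, hx⟩ := exists_edge_of_level_eq_succ hv
    obtain ⟨q', h1, h2, h3⟩ := ih x (v :: q) (by have := hx.2; omega)
      (List.isChain_cons_cons.2 ⟨hx, hq⟩)
    exact ⟨q', h1, by simp at h2; omega, fun y hy => h3 (List.mem_cons_of_mem _ hy)⟩

variable [Fintype V]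

theorem level_le_height (x : V) : T.level x ≤ T.height :=
  Finset.le_sup (f := T.level) (Finset.mem_univ x)

/-- Two directed paths of the same length through a vertex of maximal level agree, since they end
there and a vertex has at most one parent. -/
theorem IsDirectedPath.eq_of_mem {t : ℕ} {p q : List V} (hp : T.IsDirectedPath t p)
    (hq : T.IsDirectedPath t q) {v : V} (hv : T.level v = T.height) (hvp : v ∈ p) (hvq : v ∈ q) :
    p = q := by
  have hlast : ∀ l : List V, T.IsDirectedPath t l → v ∈ l → ∃ h : t - 1 < l.length,
      l[t - 1] = v := by
    rintro l ⟨hl, -, hc⟩ hvl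
    obtain ⟨i, hi, rfl⟩ := List.getElem_of_mem hvl
    have h1 : t - 1 < l.length := by omega
    have h2 := level_getElem hc i hi
    have h3 := level_getElem hc _ h1
    have h4 := T.level_le_height l[t - 1]
    have h5 : i = t - 1 := by omega
    subst h5
    exact ⟨h1, rfl⟩
  obtain ⟨hp1, hp2⟩ := hlast p hp hvp
  obtain ⟨hq1, hq2⟩ := hlast q hq hvq
  obtain ⟨hpl, -, hpc⟩ := hp
  obtain ⟨hql, -, hqc⟩ := hq
  have key : ∀ d i (hi : i < t), i + d = t - 1 → p[i] = q[i] := by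
    intro d
    induction d with
    | zero =>
      intro i hi hd
      obtain rfl : i = t - 1 := by omega
      rw [hp2, hq2]
    | succ d ih =>
      intro i hi hd
      have e1 := List.isChain_iff_getElem.1 hpc i (by omega)
      have e2 := List.isChain_iff_getElem.1 hqc i (by omega)
      rw [ih (i + 1) (by omega) (by omega)] at e1
      exact e1.eq_of_edge e2
  refine List.ext_getElem (by omega) fun i h1 h2 => key (t - 1 - i) i (by omega) (by omega)

section Nary

variable {k : ℕ}

theorem card_level_eq (hT : T.IsNary k) {i : ℕ} (hi : i ≤ T.height) :
    (Finset.univ.filter fun v => T.level v = i).card = k ^ i := by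
  classical
  induction i with
  | zero =>
    have : (Finset.univ.filter fun v => T.level v = 0) = {T.root} := by
      ext v
      simp [level_eq_zero_iff]
    simp [this]
  | succ i ih =>
    have hU : (Finset.univ.filter fun v => T.level v = i + 1) =
        (Finset.univ.filter fun v => T.level v = i).biUnion
          fun x => Finset.univ.filter fun y => T.Edge x y := by
      ext y
      simp only [Finset.mem_filter, Finset.mem_univ, true_and, Finset.mem_biUnion]
      constructor
      · intro hy
        obtain ⟨x, hx⟩ := exists_edge_of_level_eq_succ hy
        exact ⟨x, by have := hx.2; omega, hx⟩
      · rintro ⟨x, hx, hxy⟩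
        rw [hxy.2, hx]
    rw [hU, Finset.card_biUnion, Finset.sum_congr rfl (g := fun _ => k), Finset.sum_const,
      ih (by omega), smul_eq_mul, pow_succ]
    · intro x hx
      rw [← hT x (by have := (Finset.mem_filter.1 hx).2; omega), outDegree,
        Set.ncard_eq_toFinset_card', Set.toFinset_ofPred]
    · intro x _ x' _ hne
      rw [Function.onFun, Finset.disjoint_left]
      intro y hy hy'
      exact hne ((Finset.mem_filter.1 hy).2.eq_of_edge (Finset.mem_filter.1 hy').2)

theorem arity_pos (hT : T.IsNary k) (hh : 1 ≤ T.height) : 0 < k := by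
  obtain ⟨v, -, hv⟩ := Finset.exists_mem_eq_sup Finset.univ ⟨T.root, Finset.mem_univ _⟩ T.level
  have h1 : 0 < (Finset.univ.filter fun v => T.level v = T.height).card :=
    Finset.card_pos.2 ⟨v, Finset.mem_filter.2 ⟨Finset.mem_univ v, hv.symm⟩⟩
  rw [card_level_eq hT le_rfl] at h1
  by_contra h0
  obtain rfl : k = 0 := by omega
  simp [zero_pow (by omega : T.height ≠ 0)] at h1

theorem exists_edge (hT : T.IsNary k) (hk : 0 < k) {x : V} (hx : T.level x < T.height) :
    ∃ y, T.Edge x y :=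
  Set.nonempty_of_ncard_ne_zero (s := {y | T.Edge x y}) (by
    have := hT x hx
    rw [outDegree] at this
    omega)

/-- Every vertex starts a directed path down to the maximal level. -/
theorem exists_isChain_to_leaf (hT : T.IsNary k) (hk : 0 < k) (n : ℕ) (v : V)
    (hv : T.level v + n = T.height) :
    ∃ q : List V, (v :: q).IsChain T.Edge ∧ q.length = n := by
  induction n generalizing v with
  | zero => exact ⟨[], by simp, rfl⟩
  | succ n ih =>
    obtain ⟨y, hy⟩ := exists_edge hT hk (x := v) (by omega)
    obtain ⟨q, hq, hl⟩ := ih y (by have := hy.2; omega)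
    exact ⟨y :: q, List.isChain_cons_cons.2 ⟨hy, hq⟩, by simp [hl]⟩

/-- Every vertex whose level is at least `height + 1 - t` lies on a directed path on `t` vertices
ending at a vertex of maximal level. -/
theorem exists_isDirectedPath_mem (hT : T.IsNary k) (hk : 0 < k) {t : ℕ} (ht : 1 ≤ t)
    (ht' : t ≤ T.height + 1) {v : V} (hv : T.height + 1 - t ≤ T.level v) :
    ∃ p, T.IsDirectedPath t p ∧ v ∈ p ∧ ∃ w ∈ p, T.level w = T.height := by
  have hvh := T.level_le_height v
  obtain ⟨q₀, hq₀, hl₀⟩ := exists_isChain_to_leaf hT hk (T.height - T.level v) v (by omega)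
  obtain ⟨q, hq, hl, hvq⟩ := exists_isChain_to_root _ v q₀ rfl hq₀
  have hlen : q.length = T.height + 1 := by omega
  have hlast := level_getElem hq T.height (by omega)
  have hlast' := T.level_le_height (q[T.height]'(by omega))
  obtain ⟨i, hi, rfl⟩ := List.getElem_of_mem hvq
  have hli := level_getElem hq i hi
  have hmem : ∀ j (hj : j < q.length), T.height + 1 - t ≤ j → q[j] ∈ q.drop (T.height + 1 - t) := by
    intro j hj hcj
    rw [List.mem_drop_iff_getElem]
    exact ⟨j - (T.height + 1 - t), by omega, by congr 1; omega⟩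
  refine ⟨q.drop (T.height + 1 - t), ⟨by rw [List.length_drop]; omega, ?_, hq.drop _⟩,
    hmem i hi (by omega), q[T.height], hmem _ _ (by omega), by omega⟩
  exact nodup_of_isChain (hq.drop _)

theorem card_level_Ico (hT : T.IsNary k) (c : ℕ) :
    (Finset.univ.filter fun v => c ≤ T.level v ∧ T.level v < T.height).card =
      ∑ i ∈ Finset.Ico c T.height, k ^ i := by
  rw [Finset.card_eq_sum_card_fiberwise (f := T.level) (t := Finset.Ico c T.height)]
  · refine Finset.sum_congr rfl fun i hi => ?_
    rw [Finset.mem_Ico] at hi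
    rw [← card_level_eq hT hi.2.le, Finset.filter_filter]
    congr 1
    ext v
    simp only [Finset.mem_filter, Finset.mem_univ, true_and]
    constructor
    · exact fun h => h.2
    · intro h
      exact ⟨by omega, h⟩
  · intro v hv
    simpa using hv

end Nary

end DirectedRootedTree

/-! ### Path ideals of height and height plus one -/

namespace DirectedRootedTree

open GradedFree

variable {V : Type*} {K : Type*} [Field K] {T : DirectedRootedTree V}

/-- The vertex sets of the directed paths on `t` vertices: the generators of the path ideal. -/
def PathSet [DecidableEq V] (T : DirectedRootedTree V) (t : ℕ) : Type _ :=
  {P : Finset V // ∃ p : List V, T.IsDirectedPath t p ∧ p.toFinset = P}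

theorem pathIdeal_eq [DecidableEq V] (t : ℕ) :
    T.pathIdeal K t = monomialIdeal K fun P : T.PathSet t => expo P.1 := by
  rw [pathIdeal, monomialIdeal]
  congr 1
  ext f
  constructor
  · rintro ⟨p, hp, rfl⟩
    exact ⟨_, ⟨⟨p.toFinset, p, hp, rfl⟩, rfl⟩, (prod_map_X_eq hp.2.1).symm⟩
  · rintro ⟨_, ⟨⟨_, p, hp, rfl⟩, rfl⟩, rfl⟩
    exact ⟨p, hp, (prod_map_X_eq hp.2.1).symm⟩

variable [Fintype V]

/-- A directed path on `height` or `height + 1` vertices has at most one vertex in the union of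
the levels below `height + 1 - t` and the level `height`. -/
theorem card_filter_path_le_one [DecidableEq V] {t : ℕ} (ht : T.height ≤ t) (P : T.PathSet t) :
    (P.1.filter fun v => ¬ (T.height + 1 - t ≤ T.level v ∧ T.level v < T.height)).card ≤ 1 := by
  obtain ⟨_, p, ⟨hl, -, hc⟩, rfl⟩ := P
  rw [Finset.card_le_one]
  intro a ha b hb
  simp only [Finset.mem_filter, List.mem_toFinset] at ha hb
  obtain ⟨i, hi, rfl⟩ := List.getElem_of_mem ha.1
  obtain ⟨j, hj, rfl⟩ := List.getElem_of_mem hb.1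
  have h1 := level_getElem hc i hi
  have h2 := level_getElem hc j hj
  have h3 := level_getElem hc (t - 1) (by omega)
  have h4 := T.level_le_height (p[t - 1]'(by omega))
  obtain rfl : i = j := by omega
  rfl

theorem card_biUnion_path_le [DecidableEq V] {t : ℕ} (ht : T.height ≤ t)
    (A : Finset (T.PathSet t)) :
    (A.biUnion fun P => P.1).card ≤ A.card +
      (Finset.univ.filter fun v => T.height + 1 - t ≤ T.level v ∧ T.level v < T.height).card := by
  rw [← Finset.card_filter_add_card_filter_not
    (fun v => T.height + 1 - t ≤ T.level v ∧ T.level v < T.height), add_comm]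
  refine add_le_add ?_ (Finset.card_le_card fun v hv => ?_)
  · rw [Finset.filter_biUnion]
    refine Finset.card_biUnion_le.trans ?_
    rw [Finset.card_eq_sum_ones]
    exact Finset.sum_le_sum fun P _ => card_filter_path_le_one ht P
  · exact Finset.mem_filter.2 ⟨Finset.mem_univ v, (Finset.mem_filter.1 hv).2⟩

theorem PathSet.eq_of_mem [DecidableEq V] {t : ℕ} {P Q : T.PathSet t} {v : V}
    (hv : T.level v = T.height) (hP : v ∈ P.1) (hQ : v ∈ Q.1) : P = Q := by
  obtain ⟨_, p, hp, rfl⟩ := P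
  obtain ⟨_, q, hq, rfl⟩ := Q
  rw [List.mem_toFinset] at hP hQ
  obtain rfl := hp.eq_of_mem hq hv hP hQ
  rfl

/-- For `t` equal to `height` or `height + 1`, the regularity of `R/I_t` is the number of vertices
in the levels from `height + 1 - t` to `height - 1`. -/
theorem hasRegularity_pathIdeal {k : ℕ} (hT : T.IsNary k) (hh : 1 ≤ T.height) {t : ℕ}
    (ht : T.height ≤ t) (ht' : t ≤ T.height + 1) :
    HasRegularity (T.pathIdeal K t)
      ((∑ i ∈ Finset.Ico (T.height + 1 - t) T.height, k ^ i : ℕ) : ℤ) := by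
  classical
  have hk := arity_pos hT hh
  have hfin : Finite (T.PathSet t) := Subtype.finite
  have := Fintype.ofFinite (T.PathSet t)
  -- The paths ending at a vertex of maximal level.
  let A₀ : Finset (T.PathSet t) := Finset.univ.filter fun P => ∃ v ∈ P.1, T.level v = T.height
  have hA₀ : ∀ P, P ∈ A₀ ↔ ∃ v ∈ P.1, T.level v = T.height := fun P => by simp [A₀]
  rw [pathIdeal_eq, ← card_level_Ico hT]
  refine hasRegularity_squarefree (P := fun P : T.PathSet t => P.1) ?_ (card_biUnion_path_le ht)
    (A₀ := A₀) (le_antisymm (card_biUnion_path_le ht A₀) ?_) ?_ ?_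
  · rintro ⟨_, p, ⟨hl, -, -⟩, rfl⟩
    exact List.toFinset_nonempty_iff p |>.2 (List.ne_nil_of_length_pos (by omega))
  -- `A₀` injects into the level `height`, and it covers all levels from `height + 1 - t` on.
  · have h1 : A₀.card ≤ (Finset.univ.filter fun v => T.level v = T.height).card := by
      have : Nonempty V := ⟨T.root⟩
      choose! f hf hf' using fun P => (hA₀ P).1
      refine Finset.card_le_card_of_injOn f (fun P hP => by simpa using hf' P hP) ?_
      intro P hP Q hQ h
      exact PathSet.eq_of_mem (hf' P hP) (hf P hP) (h ▸ hf Q hQ)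
    have h2 : (Finset.univ.filter fun v => T.level v = T.height) ∪
        (Finset.univ.filter fun v => T.height + 1 - t ≤ T.level v ∧ T.level v < T.height) ⊆
        A₀.biUnion fun P => P.1 := by
      intro v hv
      have hv' : T.height + 1 - t ≤ T.level v := by
        simp only [Finset.mem_union, Finset.mem_filter, Finset.mem_univ, true_and] at hv
        omega
      obtain ⟨p, hp, hvp, w, hw, hwl⟩ := exists_isDirectedPath_mem hT hk (by omega) ht' hv'
      exact Finset.mem_biUnion.2 ⟨⟨p.toFinset, p, hp, rfl⟩,
        (hA₀ _).2 ⟨w, List.mem_toFinset.2 hw, hwl⟩, List.mem_toFinset.2 hvp⟩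
    have h3 := Finset.card_le_card h2
    rw [Finset.card_union_of_disjoint] at h3
    · omega
    · rw [Finset.disjoint_filter]
      intro v _ h4 h5
      omega
  -- The vertex of maximal level on a path of `A₀` lies on no other path.
  · intro P hP h
    obtain ⟨v, hvP, hv⟩ := (hA₀ P).1 hP
    have hmem : v ∈ (A₀.erase P).biUnion fun P => P.1 := by
      rw [h]
      exact Finset.mem_biUnion.2 ⟨P, hP, hvP⟩
    obtain ⟨Q, hQ, hvQ⟩ := Finset.mem_biUnion.1 hmem
    exact Finset.ne_of_mem_erase hQ (PathSet.eq_of_mem hv hvQ hvP)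
  -- A path outside `A₀` starts in a level below `height + 1 - t`, where no path of `A₀` passes.
  · intro P hP h
    obtain ⟨_, p, ⟨hl, hn, hc⟩, rfl⟩ := P
    have hlt : T.level (p[0]'(by omega)) < T.height + 1 - t := by
      have h1 := level_getElem hc (t - 1) (by omega)
      have h2 := T.level_le_height (p[t - 1]'(by omega))
      have h3 : T.level (p[t - 1]'(by omega)) ≠ T.height := fun h3 =>
        hP ((hA₀ _).2 ⟨_, List.mem_toFinset.2 (List.getElem_mem _), h3⟩)
      omega
    have hmem : p[0] ∈ A₀.biUnion fun P => P.1 := by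
      rw [← h]
      exact Finset.mem_biUnion.2 ⟨_, Finset.mem_insert_self _ _,
        List.mem_toFinset.2 (List.getElem_mem _)⟩
    obtain ⟨⟨_, q, ⟨hql, hqn, hqc⟩, rfl⟩, hQ, hpQ⟩ := Finset.mem_biUnion.1 hmem
    obtain ⟨w, hw, hwl⟩ := (hA₀ _).1 hQ
    obtain ⟨i, hi, rfl⟩ := List.getElem_of_mem (List.mem_toFinset.1 hw)
    obtain ⟨j, hj, hpj⟩ := List.getElem_of_mem (List.mem_toFinset.1 hpQ)
    have h1 := level_getElem hqc i hi
    have h2 := level_getElem hqc j hj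
    rw [hpj] at h2
    omega

end DirectedRootedTree

theorem mainTheorem11 {V : Type*} [Fintype V] {K : Type*} [Field K]
    (T : DirectedRootedTree V) (k : ℕ) (hT : T.IsNary k) (hh : 1 ≤ T.height) :
    (∃ r : ℤ, HasRegularity (T.pathIdeal K (T.height + 1)) r ∧
      (k ≠ 1 → (r : ℚ) = ((k : ℚ) ^ T.height - 1) / ((k : ℚ) - 1)) ∧
      (k = 1 → r = (T.height : ℤ))) ∧
    (∃ r : ℤ, HasRegularity (T.pathIdeal K T.height) r ∧
      (k ≠ 1 → (r : ℚ) = ((k : ℚ) ^ T.height - k) / ((k : ℚ) - 1)) ∧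
      (k = 1 → r = (T.height : ℤ) - 1)) := by
  refine ⟨⟨_, T.hasRegularity_pathIdeal hT hh (Nat.le_succ _) le_rfl, fun hk => ?_, ?_⟩,
    ⟨_, T.hasRegularity_pathIdeal hT hh le_rfl (Nat.le_succ _), fun hk => ?_, ?_⟩⟩
  · have hk' : (k : ℚ) ≠ 1 := by exact_mod_cast hk
    push_cast
    rw [Nat.sub_self, geom_sum_Ico hk' (Nat.zero_le _), pow_zero]
  · rintro rfl
    simp
  · have hk' : (k : ℚ) ≠ 1 := by exact_mod_cast hk
    push_cast
    rw [Nat.add_sub_cancel_left, geom_sum_Ico hk' hh, pow_one]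
  · rintro rfl
    simp [hh]
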